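/- Let $\Gamma\subset\mathrm{PSL}_2(\mathbb R)$ be a Fuchsian (i.e. discrete) group acting on the upper half-plane $\mathbb H$ and having a fundamental domain $\mathcal F$ of finite area for the hyperbolic measure $d\mu_{\rm hyp}=y^{-2}dx\,dy$, let $\widetilde\Gamma\subset\mathrm{SL}_2(\mathbb R)$ be the preimage of $\Gamma$ (so $-I\in\widetilde\Gamma$), let $k\in\mathbb R$, and let $V$ be a finite-dimensional complex inner product space with unitary group $U(V)$. For $\gamma\in\mathrm{SL}_2(\mathbb R)$ with lower row $(c,d)$ put $j(\gamma,z)=cz+d$ and $J_{\gamma,k}(z)=\exp(2ik\arg j(\gamma,z))$, with $\arg\in(-\pi,\pi]$; let $w(\gamma_1,\gamma_2)$ be the integer, independent of $z\in\mathbb H$, with $2\pi w(\gamma_1,\gamma_2)=\arg j(\gamma_1,\gamma_2z)+\arg j(\gamma_2,z)-\arg j(\gamma_1\gamma_2,z)$, and put $\omega_k(\gamma_1,\gamma_2)=e^{4\pi ik\,w(\gamma_1,\gamma_2)}$. Let $\chi:\widetilde\Gamma\to U(V)$ be a unitary multiplier system of weight $k$, i.e. $\chi(-I)=e^{-2\pi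 ik}\mathrm{id}_V$ and $\chi(\gamma_1\gamma_2)=\omega_k(\gamma_1,\gamma_2)\chi(\gamma_1)\chi(\gamma_2)$. Put $H_k(z,w)=\bigl(-|z-\overline w|^2/(z-\overline w)^2\bigr)^k$ (principal branch). Let $d_{\rm hyp}$ be the hyperbolic distance and $F(a,b;c;x)$ the Gauss hypergeometric function. For $z,w\in\mathbb H$ consider $$\tilde K_s(z,w)=\frac{\Gamma(s-k)\Gamma(s+k)}{\sqrt{2\pi}\,\Gamma(s)^2}\,S_s(z,w),$$ $$S_s(z,w)=\sum_{\gamma\in\widetilde\Gamma}\chi(\gamma)\cosh(d_{\rm hyp}(z,\gamma w))^{-s}F\bigl(-k,k;s;(1+\cosh d_{\rm hyp}(z,\gamma w))^{-1}\bigr)J_{\gamma,k}(w)H_k(z,\gamma w),$$ with values in $\mathrm{End}(V)$. Let $\mathcal H_k$ be the space of (classes of $\mu_{\rm hyp}$-almost everywhere equal) $\mu_{\rm hyp}$-measurable $f:\mathbb H\to V$ with $f(\gamma z)J_{\gamma,k}(z)^{-1}=\chi(\gamma)f(z)$ for all $\gamma\in\widetilde\Gamma$ and $\int_{\mathcal F}|f|_V^2\,d\mu_{\rm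 hyp}<\infty$. Then: (a) The series $S_s(z,w)$ converges normally for the operator norm of $\mathrm{End}(V)$ in the variables $(z,w;s)$, $\Re(s)>1$: for every compact $C\subset\mathbb H\times\mathbb H$ and every $\sigma>1$, its terms are bounded on $C\times\{\Re(s)\ge\sigma\}$ by the terms of a convergent series of constants; in particular the convergence is uniform there. For all $z,w\in\mathbb H$, $s\mapsto S_s(z,w)$ is holomorphic in $\Re(s)>1$. (b) For all $z,w\in\mathbb H$, $s\mapsto\tilde K_s(z,w)$ is meromorphic in the half-plane $\Re(s)>1$. It is holomorphic there outside the points $s=|k|-n$ with $n$ an integer in $[0,|k|-1]$; every pole in the half-plane is simple and is one of these points, and poles occur there only if $|k|>1$. A point $s_0=|k|-n$ with integer $n\ge0$ and $s_0>1$ is a (simple) pole if and only if $S_{s_0}(z,w)\neq0$. (c) For every $w\in\mathbb H$ and every $s$ with $\Re(s)>\max\{1,|k|\}$, each column of $\tilde K_s(\cdot,w)$, and more generally $z\mapsto\tilde K_s(z,w)v$ for each $v\in V$, belongs to $\mathcal H_k$. -/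

import Mathlib

open UpperHalfPlane MeasureTheory
open scoped MatrixGroups

noncomputable section

namespace GeomKernel

/-- The group `PSL₂(ℝ)`, with the quotient topology. -/
abbrev PSL2R : Type := Matrix.ProjectiveSpecialLinearGroup (Fin 2) ℝ

/-- The centre `{± I}` of `SL₂(ℝ)` acts trivially on the upper half-plane. -/
theorem center_le_ker :
    Subgroup.center SL(2, ℝ) ≤ (MulAction.toPermHom SL(2, ℝ) ℍ).ker := by
  intro g hg
  obtain ⟨r, hr, h⟩ := Matrix.SpecialLinearGroup.mem_center_iff.mp hg
  have hr0 : r ≠ 0 := by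
    rintro rfl
    simp at hr
  have h00 : g 0 0 = r := by rw [← h]; simp
  have h01 : g 0 1 = 0 := by rw [← h]; simp
  have h10 : g 1 0 = 0 := by rw [← h]; simp
  have h11 : g 1 1 = r := by rw [← h]; simp
  rw [MonoidHom.mem_ker]
  ext z
  have hc : (r : ℂ) ≠ 0 := by exact_mod_cast hr0
  simp [UpperHalfPlane.coe_specialLinearGroup_apply, h00, h01, h10, h11, hc]

/-- The action of `PSL₂(ℝ)` on the upper half-plane by fractional linear transformations, obtained
from Mathlib's action of `SL₂(ℝ)`. -/
instance pslAction : MulAction PSL2R ℍ :=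
  MulAction.compHom ℍ
    (QuotientGroup.lift (Subgroup.center SL(2, ℝ)) (MulAction.toPermHom SL(2, ℝ) ℍ) center_le_ker)

theorem psl_mk_smul (g : SL(2, ℝ)) (z : ℍ) :
    (QuotientGroup.mk g : PSL2R) • z = g • z := rfl

/-- The cover of `Γ ⊆ PSL₂(ℝ)` in `SL₂(ℝ)`: all `γ` whose class `[± γ]` lies in `Γ`. -/
def cover (Γ : Subgroup PSL2R) : Subgroup SL(2, ℝ) :=
  Γ.comap (QuotientGroup.mk' (Subgroup.center SL(2, ℝ)))

theorem neg_one_mem_cover (Γ : Subgroup PSL2R) : (-1 : SL(2, ℝ)) ∈ cover Γ := by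
  have h : (-1 : SL(2, ℝ)) ∈ Subgroup.center SL(2, ℝ) := by
    rw [Subgroup.mem_center_iff]
    intro g
    simp
  have h1 : QuotientGroup.mk' (Subgroup.center SL(2, ℝ)) (-1 : SL(2, ℝ)) = 1 :=
    (QuotientGroup.eq_one_iff _).mpr h
  rw [cover, Subgroup.mem_comap, h1]
  exact Γ.one_mem

/-- `j(γ, z) = c z + d`, where `(c, d)` is the lower row of `γ`. -/
def j (γ : SL(2, ℝ)) (z : ℍ) : ℂ := (γ 1 0 : ℂ) * (z : ℂ) + (γ 1 1 : ℂ)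

/-- `J_{γ,k}(z) = exp(2 i k arg (c z + d))`, with `arg` in `(-π, π]`. -/
def J (k : ℝ) (γ : SL(2, ℝ)) (z : ℍ) : ℂ :=
  Complex.exp (2 * Complex.I * k * ((j γ z).arg : ℂ))

/-- The number `w(γ₁, γ₂)` with
`2π w(γ₁, γ₂) = arg j(γ₁, γ₂ z) + arg j(γ₂, z) - arg j(γ₁ γ₂, z)`. The right-hand side is an integer
multiple of `2π` which does not depend on `z ∈ ℍ`, so it is evaluated at `z = i`. -/
def wFactor (γ₁ γ₂ : SL(2, ℝ)) : ℝ :=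
  ((j γ₁ (γ₂ • UpperHalfPlane.I)).arg + (j γ₂ UpperHalfPlane.I).arg
    - (j (γ₁ * γ₂) UpperHalfPlane.I).arg) / (2 * Real.pi)

/-- The factor system `ω_k(γ₁, γ₂) = exp(4 π i k w(γ₁, γ₂))` of weight `k`. -/
def omega (k : ℝ) (γ₁ γ₂ : SL(2, ℝ)) : ℂ :=
  Complex.exp (4 * Real.pi * Complex.I * k * wFactor γ₁ γ₂)

/-- The principal-branch power `H_k(z, w) = (- |z - w̄|² / (z - w̄)²) ^ k`. -/
def H (k : ℝ) (z w : ℍ) : ℂ :=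
  (-((‖(z : ℂ) - (starRingEnd ℂ) (w : ℂ)‖ : ℂ) ^ 2 /
    ((z : ℂ) - (starRingEnd ℂ) (w : ℂ)) ^ 2)) ^ (k : ℂ)

variable {V : Type*} [NormedAddCommGroup V] [InnerProductSpace ℂ V]

/-- `χ : Γ̃ → U(V)` is a unitary multiplier system of weight `k` on the cover `Γ̃` of `Γ`. -/
structure IsMultiplierSystem (Γ : Subgroup PSL2R) (k : ℝ) (χ : cover Γ → (V ≃ₗᵢ[ℂ] V)) :
    Prop where
  map_neg_one : ∀ v : V, χ ⟨-1, neg_one_mem_cover Γ⟩ v =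
    Complex.exp (-(2 * Real.pi * Complex.I * k)) • v
  map_mul : ∀ (γ₁ γ₂ : cover Γ) (v : V), χ (γ₁ * γ₂) v = omega k γ₁ γ₂ • χ γ₁ (χ γ₂ v)

/-- The unitary operator `χ(γ)` as an element of `End(V)`, which carries the operator norm. -/
def toEnd (u : V ≃ₗᵢ[ℂ] V) : V →L[ℂ] V := (u.toContinuousLinearEquiv : V →L[ℂ] V)

/-- The summand
`χ(γ) cosh(d(z,γw))^{-s} F(-k, k; s; (1 + cosh d(z,γw))⁻¹) J_{γ,k}(w) H_k(z, γw)`. -/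
def term (Γ : Subgroup PSL2R) (k : ℝ) (χ : cover Γ → (V ≃ₗᵢ[ℂ] V)) (γ : cover Γ)
    (s : ℂ) (z w : ℍ) : V →L[ℂ] V :=
  ((Real.cosh (dist z ((γ : SL(2, ℝ)) • w)) : ℂ) ^ (-s)
    * ordinaryHypergeometric (-(k : ℂ)) (k : ℂ) s
        (((1 + Real.cosh (dist z ((γ : SL(2, ℝ)) • w)))⁻¹ : ℝ) : ℂ)
    * J k (γ : SL(2, ℝ)) w * H k z ((γ : SL(2, ℝ)) • w)) • toEnd (χ γ)

/-- The sum over `Γ̃` in the definition of the geometric automorphic kernel. -/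
def kernelSum (Γ : Subgroup PSL2R) (k : ℝ) (χ : cover Γ → (V ≃ₗᵢ[ℂ] V))
    (s : ℂ) (z w : ℍ) : V →L[ℂ] V :=
  ∑' γ : cover Γ, term Γ k χ γ s z w

/-- The factor `Γ(s - k) Γ(s + k) / (√(2π) Γ(s)²)`. -/
def gammaFactor (k : ℝ) (s : ℂ) : ℂ :=
  Complex.Gamma (s - k) * Complex.Gamma (s + k) /
    ((Real.sqrt (2 * Real.pi) : ℂ) * Complex.Gamma s ^ 2)

/-- The geometric automorphic kernel `K̃_s(z, w)`. -/
def kernel (Γ : Subgroup PSL2R) (k : ℝ) (χ : cover Γ → (V ≃ₗᵢ[ℂ] V))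
    (s : ℂ) (z w : ℍ) : V →L[ℂ] V :=
  gammaFactor k s • kernelSum Γ k χ s z w

/-- `f : ℍ → V` is (a representative of) an element of the Hilbert space `ℋ_k`: it is measurable
for the hyperbolic measure `dx dy / y²` (the volume on `ℍ`), satisfies
`f(γz) J_{γ,k}(z)⁻¹ = χ(γ) f(z)` for all `γ ∈ Γ̃`, and is square-integrable on the fundamental
domain `F`. -/
structure MemHk (Γ : Subgroup PSL2R) (k : ℝ) (χ : cover Γ → (V ≃ₗᵢ[ℂ] V)) (F : Set ℍ)
    (f : ℍ → V) : Prop where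
  aestronglyMeasurable : AEStronglyMeasurable f (volume : Measure ℍ)
  slash_eq : ∀ (γ : cover Γ) (z : ℍ),
    (J k (γ : SL(2, ℝ)) z)⁻¹ • f ((γ : SL(2, ℝ)) • z) = χ γ (f z)
  square_integrable : ∫⁻ z in F, ‖f z‖ₑ ^ 2 ∂(volume : Measure ℍ) < ⊤

end GeomKernel

end

/-! For a discrete group, the points of an orbit lying in a ball of fixed radius around any point of
`ℍ` are bounded in number, and `cosh (dist z ·) ^ (-σ)` varies by a bounded factor on such balls.
Hence the Poincaré series `∑ cosh (dist z (γ w)) ^ (-σ)` is bounded, uniformly in `z`, by a multiple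
of `∫ cosh (dist z ·) ^ (-σ) dμ_hyp`, which is finite exactly for `σ > 1`. The remaining factors of
the summand are unimodular, isometric, or hypergeometric values that stay bounded for `Re s ≥ σ`,
which gives normal convergence. The poles of the kernel on `Re s > 1` are then those of `Γ(s - |k|)`
which are not cancelled by a zero of the sum. Finally the sum is bounded in `z` and transforms by
`χ` and `J`, so it is square integrable wherever the area is finite. -/

noncomputable section

namespace GeomKernel

/-! ### Discrete subgroups of `SL(2, ℝ)` acting on the upper half-plane -/

theorem discreteTopology_comap {G G' : Type*} [Group G] [TopologicalSpace G]
    [IsTopologicalGroup G] [T1Space G] [Group G'] [TopologicalSpace G'] {f : G →* G'}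
    (hf : Continuous f) (hker : Finite f.ker) (Γ : Subgroup G') [DiscreteTopology Γ] :
    DiscreteTopology (Γ.comap f) := by
  refine discreteTopology_of_isOpen_singleton_one ?_
  have hf' : Continuous fun γ : Γ.comap f => (⟨f γ, γ.2⟩ : Γ) :=
    (hf.comp continuous_subtype_val).subtype_mk _
  have hopen : IsOpen {γ : Γ.comap f | f γ = 1} := by
    convert (isOpen_discrete {(1 : Γ)}).preimage hf' using 1
    ext γ
    simp [Subtype.ext_iff]
  have hfin : {γ : Γ.comap f | f γ = 1}.Finite :=
    (Set.toFinite (f.ker : Set G)).preimage Subtype.val_injective.injOn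
  have hdiff : IsOpen ({γ : Γ.comap f | f γ = 1} \ ({γ | f γ = 1} \ {1})) :=
    hopen.sdiff (hfin.subset Set.sdiff_subset).isClosed
  rwa [Set.sdiff_sdiff_cancel_left (by simp)] at hdiff

instance (n R : Type*) [Fintype n] [DecidableEq n] [CommRing R] [IsDomain R] :
    Finite (Subgroup.center (Matrix.SpecialLinearGroup n R)) := by
  have : NeZero (max (Fintype.card n) 1) := ⟨by simp⟩
  exact Finite.of_equiv _
    (Matrix.SpecialLinearGroup.center_equiv_rootsOfUnity (n := n) (R := R)).symm.toEquiv

instance (Γ : Subgroup PSL2R) [DiscreteTopology Γ] : DiscreteTopology (cover Γ) :=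
  discreteTopology_comap (f := QuotientGroup.mk' (Subgroup.center SL(2, ℝ)))
    QuotientGroup.continuous_mk (by rw [QuotientGroup.ker_mk']; infer_instance) Γ

theorem finite_setOf_dist_smul_le {G X : Type*} [Group G] [PseudoMetricSpace X] [ProperSpace X]
    [MulAction G X] [ProperlyDiscontinuousSMul G X] (x y : X) (r : ℝ) :
    {g : G | dist x (g • y) ≤ r}.Finite :=
  (ProperlyDiscontinuousSMul.finite_disjoint_inter_image (Γ := G)
    (isCompact_singleton (x := y)) (isCompact_closedBall x r)).subset fun g hg =>
    ⟨g • y, ⟨y, rfl, rfl⟩, Metric.mem_closedBall'.mpr hg⟩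

instance : SMulInvariantMeasure SL(2, ℝ) ℍ volume :=
  ⟨fun g _ hs => SMulInvariantMeasure.measure_preimage_smul
    (Matrix.SpecialLinearGroup.toGL g) hs⟩

/-! ### Sums over an orbit compared with integrals -/

section Packing

variable {G X : Type*} [Group G]

theorem sum_setLIntegral_le_mul_lintegral {ι : Type*} [MeasurableSpace X] {μ : Measure X}
    {A : ι → Set X} (hA : ∀ i, MeasurableSet (A i)) {N : ℕ∞} (hN : ∀ x, {i | x ∈ A i}.encard ≤ N)
    {h : X → ENNReal} (hh : Measurable h) (T : Finset ι) :
    ∑ i ∈ T, ∫⁻ x in A i, h x ∂μ ≤ N * ∫⁻ x, h x ∂μ := by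
  classical
  calc ∑ i ∈ T, ∫⁻ x in A i, h x ∂μ = ∫⁻ x, ∑ i ∈ T, (A i).indicator h x ∂μ := by
        rw [lintegral_finsetSum _ fun i _ => hh.indicator (hA i)]
        exact Finset.sum_congr rfl fun i _ => (lintegral_indicator (hA i) h).symm
    _ ≤ ∫⁻ x, N * h x ∂μ := lintegral_mono fun x => ?_
    _ = N * ∫⁻ x, h x ∂μ := lintegral_const_mul _ hh
  have hcard : ((T.filter (x ∈ A ·)).card : ℕ∞) ≤ N := by
    rw [← Set.encard_coe_eq_coe_finsetCard]
    exact (Set.encard_le_encard fun i hi => (Finset.mem_filter.mp hi).2).trans (hN x)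
  simp only [Set.indicator_apply, Finset.sum_ite, Finset.sum_const_zero, add_zero,
    Finset.sum_const, nsmul_eq_mul]
  gcongr
  exact_mod_cast ENat.toENNReal_le.mpr hcard

theorem encard_setOf_mem_ball_smul_le [PseudoMetricSpace X] [MulAction G X]
    [IsIsometricSMul G X] (w x : X) (r : ℝ) :
    {g : G | x ∈ Metric.ball (g • w) r}.encard ≤ {g : G | dist w (g • w) ≤ 2 * r}.encard := by
  rcases Set.eq_empty_or_nonempty {g : G | x ∈ Metric.ball (g • w) r} with h | ⟨g₀, hg₀⟩
  · rw [h, Set.encard_empty]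
    exact zero_le
  refine Set.encard_le_encard_of_injOn (f := fun g => g₀⁻¹ * g) (fun g hg => ?_)
    (mul_right_injective g₀⁻¹).injOn
  calc dist w ((g₀⁻¹ * g) • w) = dist (g₀ • w) (g • w) := by
        rw [mul_smul, ← dist_smul g₀, smul_inv_smul]
    _ ≤ dist x (g₀ • w) + dist x (g • w) := dist_triangle_left _ _ _
    _ ≤ 2 * r := by linarith [Metric.mem_ball.mp hg₀, Metric.mem_ball.mp hg]

/- By the Harnack condition the value of `h` at an orbit point is controlled by its mean over the
ball around that point, and these balls overlap boundedly often. -/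
theorem tsum_smul_mul_measure_ball_le [PseudoMetricSpace X] [MeasurableSpace X]
    [OpensMeasurableSpace X] [MulAction G X] [IsIsometricSMul G X] [MeasurableConstSMul G X]
    {μ : Measure X} [SMulInvariantMeasure G X μ] {h : X → ENNReal} (hh : Measurable h)
    {C : ENNReal} {r : ℝ}
    (hC : ∀ x y, dist x y < r → h x ≤ C * h y) (w : X) :
    (∑' g : G, h (g • w)) * μ (Metric.ball w r) ≤
      C * ({g : G | dist w (g • w) ≤ 2 * r}.encard * ∫⁻ x, h x ∂μ) := by
  have hmean (g : G) :
      h (g • w) * μ (Metric.ball w r) ≤ C * ∫⁻ x in Metric.ball (g • w) r, h x ∂μ := by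
    rw [← measure_smul μ g (Metric.ball w r), Metric.smul_ball, ← setLIntegral_const,
      ← lintegral_const_mul _ hh]
    exact setLIntegral_mono (hh.const_mul C) fun x hx => hC _ _ (Metric.mem_ball'.mp hx)
  rw [← ENNReal.tsum_mul_right, ENNReal.tsum_eq_iSup_sum]
  refine iSup_le fun T => ?_
  calc ∑ g ∈ T, h (g • w) * μ (Metric.ball w r)
      ≤ ∑ g ∈ T, C * ∫⁻ x in Metric.ball (g • w) r, h x ∂μ := Finset.sum_le_sum fun g _ => hmean g
    _ ≤ C * ({g : G | dist w (g • w) ≤ 2 * r}.encard * ∫⁻ x, h x ∂μ) := by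
        rw [← Finset.mul_sum]
        gcongr
        exact sum_setLIntegral_le_mul_lintegral (fun _ => Metric.isOpen_ball.measurableSet)
          (fun x => encard_setOf_mem_ball_smul_le w x r) hh T

theorem lintegral_comp_dist_eq [PseudoMetricSpace X] [MeasurableSpace X] [MulAction G X]
    [IsIsometricSMul G X] [MulAction.IsPretransitive G X] [MeasurableConstSMul G X]
    {μ : Measure X} [SMulInvariantMeasure G X μ]
    (φ : ℝ → ENNReal) (x y : X) : ∫⁻ u, φ (dist x u) ∂μ = ∫⁻ u, φ (dist y u) ∂μ := by
  obtain ⟨g, rfl⟩ := MulAction.exists_smul_eq G x y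
  calc ∫⁻ u, φ (dist x u) ∂μ = ∫⁻ u, φ (dist (g • x) (g • u)) ∂μ := by simp only [dist_smul]
    _ = ∫⁻ u, φ (dist (g • x) u) ∂μ :=
      (measurePreserving_smul g μ).lintegral_comp_emb (measurableEmbedding_const_smul g)
        fun u => φ (dist (g • x) u)

end Packing

/-! ### Integration over the upper half-plane -/

theorem lintegral_eq_lintegral_comap_coe (f : ℍ → ENNReal) :
    ∫⁻ z : ℍ, f z =
      ∫⁻ z : ℍ, ENNReal.ofReal ((1 / z.im) ^ 2) * f z ∂(volume.comap UpperHalfPlane.coe) := by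
  have : Measurable fun z : ℍ => NNReal.mk z.im z.im_pos.le :=
    (continuous_im.subtype_mk _).measurable
  rw [volume_def, lintegral_withDensity_eq_lintegral_mul_non_measurable _ (by fun_prop)
    (.of_forall fun _ => ENNReal.coe_lt_top)]
  refine lintegral_congr fun z => ?_
  rw [Pi.mul_apply, ← ENNReal.ofReal_coe_nnreal]
  simp

theorem lintegral_comap_coe (f : ℂ → ENNReal) :
    ∫⁻ z : ℍ, f z ∂(volume.comap UpperHalfPlane.coe) = ∫⁻ z : ℂ in {z | 0 < z.im}, f z := by
  have hrange : {z : ℂ | 0 < z.im} = Set.range UpperHalfPlane.coe := range_coe.symm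
  rw [hrange, ← measurableEmbedding_coe.map_comap, measurableEmbedding_coe.lintegral_map]

theorem setLIntegral_re_mul_im {g h : ℝ → ENNReal} (hg : Measurable g) (hh : Measurable h)
    (s : Set ℝ) :
    ∫⁻ z : ℂ in {z | z.im ∈ s}, g z.re * h z.im = (∫⁻ x, g x) * ∫⁻ y in s, h y := by
  have hpre : {z : ℂ | z.im ∈ s} = Complex.measurableEquivRealProd ⁻¹' (Set.univ ×ˢ s) := by
    ext z
    simp
  have hprod : (volume : Measure (ℝ × ℝ)).restrict (Set.univ ×ˢ s) =
      (volume : Measure ℝ).prod (volume.restrict s) := by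
    rw [Measure.volume_eq_prod, ← Measure.prod_restrict, Measure.restrict_univ]
  rw [hpre, ← lintegral_prod_mul hg.aemeasurable hh.aemeasurable, ← hprod]
  exact Complex.volume_preserving_equiv_real_prod.setLIntegral_comp_preimage_emb
    Complex.measurableEquivRealProd.measurableEmbedding (fun p => g p.1 * h p.2) _

instance : (volume : Measure ℍ).IsOpenPosMeasure := by
  refine ⟨fun U hU hne h0 => ?_⟩
  have hm : Measurable fun z : ℂ => (((1 / ‖z.im‖₊) ^ 2 : NNReal) : ENNReal) := by fun_prop
  rw [volume_eq_lintegral] at h0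
  refine h0.not_gt ((setLIntegral_pos_iff hm).mpr ?_)
  rw [Set.inter_eq_right.mpr]
  · exact (isOpenEmbedding_coe.isOpenMap U hU).measure_pos volume (hne.image _)
  · rintro _ ⟨z, -, rfl⟩
    simp [z.im_ne_zero]

theorem integrableOn_rpow_mul_one_add_sq {σ : ℝ} (hσ : 1 < σ) :
    IntegrableOn (fun y : ℝ => y ^ (σ - 2) * (1 + y ^ 2) ^ (-σ / 2)) (Set.Ioi 0) := by
  have hm : Measurable (fun y : ℝ => y ^ (σ - 2) * (1 + y ^ 2) ^ (-σ / 2)) := by fun_prop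
  have hzero : IntegrableOn (fun y : ℝ => y ^ (σ - 2)) (Set.Ioc 0 1) :=
    (intervalIntegrable_iff_integrableOn_Ioc_of_le zero_le_one).mp
      (intervalIntegral.intervalIntegrable_rpow' (by linarith))
  have hinfty : IntegrableOn (fun y : ℝ => y ^ (-2 : ℝ)) (Set.Ioi 1) :=
    integrableOn_Ioi_rpow_of_lt (by norm_num) one_pos
  rw [← Set.Ioc_union_Ioi_eq_Ioi (zero_le_one' ℝ)]
  refine IntegrableOn.union (hzero.mono' hm.aestronglyMeasurable ?_)
    (hinfty.mono' hm.aestronglyMeasurable ?_)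
  · refine (ae_restrict_iff' measurableSet_Ioc).mpr (.of_forall fun y hy => ?_)
    have hy0 : 0 < y := hy.1
    rw [Real.norm_of_nonneg (by positivity)]
    refine mul_le_of_le_one_right (by positivity) ?_
    exact Real.rpow_le_one_of_one_le_of_nonpos (by nlinarith [sq_nonneg y]) (by linarith)
  · refine (ae_restrict_iff' measurableSet_Ioi).mpr (.of_forall fun y hy => ?_)
    have hy0 : 0 < y := zero_lt_one.trans hy
    rw [Real.norm_of_nonneg (by positivity)]
    calc y ^ (σ - 2) * (1 + y ^ 2) ^ (-σ / 2) ≤ y ^ (σ - 2) * (y ^ 2) ^ (-σ / 2) := by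
          refine mul_le_mul_of_nonneg_left ?_ (by positivity)
          exact Real.rpow_le_rpow_of_nonpos (by positivity) (by linarith) (by linarith)
      _ = y ^ (σ - 2) * y ^ (-σ) := by
          rw [← Real.rpow_natCast_mul hy0.le]
          congr 2
          push_cast
          ring
      _ = y ^ (-2 : ℝ) := by
          rw [← Real.rpow_add hy0]
          congr 1
          ring

/- The first factor of the right-hand side is integrable over `ℝ`, the second over `(0, ∞)`. -/
theorem one_div_im_sq_mul_cosh_dist_I_rpow_le {σ : ℝ} (hσ : 0 ≤ σ) (z : ℍ) :
    (1 / z.im) ^ 2 * Real.cosh (dist I z) ^ (-σ) ≤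
      2 ^ σ * (1 + z.re ^ 2) ^ (-σ / 2) * (z.im ^ (σ - 2) * (1 + z.im ^ 2) ^ (-σ / 2)) := by
  have hy := z.im_pos
  have hcosh : Real.cosh (dist I z) = 2⁻¹ * (z.im⁻¹ * (1 + z.re ^ 2 + z.im ^ 2)) := by
    rw [cosh_dist', I_re, I_im]
    field_simp
    ring
  have hsplit : (1 + z.re ^ 2 + z.im ^ 2) ^ (-σ) ≤
      (1 + z.re ^ 2) ^ (-σ / 2) * (1 + z.im ^ 2) ^ (-σ / 2) := by
    rw [← add_halves (-σ), Real.rpow_add (by positivity), add_halves]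
    refine mul_le_mul ?_ ?_ (by positivity) (by positivity)
    · exact Real.rpow_le_rpow_of_nonpos (by positivity) (by nlinarith) (by linarith)
    · exact Real.rpow_le_rpow_of_nonpos (by positivity) (by nlinarith [sq_nonneg z.re])
        (by linarith)
  calc (1 / z.im) ^ 2 * Real.cosh (dist I z) ^ (-σ)
      = 2 ^ σ * z.im ^ (σ - 2) * (1 + z.re ^ 2 + z.im ^ 2) ^ (-σ) := by
        rw [hcosh, Real.mul_rpow (by positivity) (by positivity),
          Real.mul_rpow (by positivity) (by positivity), Real.inv_rpow zero_le_two,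
          Real.inv_rpow hy.le, Real.rpow_neg zero_le_two, Real.rpow_neg hy.le, Real.rpow_sub hy,
          Real.rpow_two]
        field_simp
    _ ≤ 2 ^ σ * z.im ^ (σ - 2) * ((1 + z.re ^ 2) ^ (-σ / 2) * (1 + z.im ^ 2) ^ (-σ / 2)) :=
        mul_le_mul_of_nonneg_left hsplit (by positivity)
    _ = _ := by ring

theorem lintegral_cosh_dist_rpow_lt_top {σ : ℝ} (hσ : 1 < σ) (w : ℍ) :
    ∫⁻ z : ℍ, ENNReal.ofReal (Real.cosh (dist w z) ^ (-σ)) < ⊤ := by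
  set g : ℝ → ENNReal := fun x => ENNReal.ofReal (2 ^ σ * (1 + x ^ 2) ^ (-σ / 2))
  set h : ℝ → ENNReal := fun y => ENNReal.ofReal (y ^ (σ - 2) * (1 + y ^ 2) ^ (-σ / 2))
  have hg : ∫⁻ x, g x < ⊤ := by
    have hint : Integrable (fun x : ℝ => (1 + ‖x‖ ^ 2) ^ (-σ / 2)) :=
      integrable_rpow_neg_one_add_norm_sq (by simpa using hσ)
    simp only [Real.norm_eq_abs, sq_abs] at hint
    exact (hint.const_mul (2 ^ σ)).lintegral_lt_top
  have hh : ∫⁻ y in Set.Ioi 0, h y < ⊤ := (integrableOn_rpow_mul_one_add_sq hσ).lintegral_lt_top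
  have hle : ∫⁻ z : ℍ, ENNReal.ofReal (Real.cosh (dist I z) ^ (-σ)) ≤
      ∫⁻ z : ℍ, g z.re * h z.im ∂(volume.comap UpperHalfPlane.coe) := by
    rw [lintegral_eq_lintegral_comap_coe]
    refine lintegral_mono fun z => ?_
    rw [← ENNReal.ofReal_mul (by positivity), ← ENNReal.ofReal_mul (by positivity)]
    exact ENNReal.ofReal_le_ofReal (one_div_im_sq_mul_cosh_dist_I_rpow_le (by linarith) z)
  rw [lintegral_comp_dist_eq (G := SL(2, ℝ)) (fun d => ENNReal.ofReal (Real.cosh d ^ (-σ))) w I]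
  refine hle.trans_lt ?_
  have hprod := lintegral_comap_coe fun z => g z.re * h z.im
  simp only [coe_re, coe_im] at hprod
  rw [hprod]
  exact (setLIntegral_re_mul_im (by fun_prop) (by fun_prop) (Set.Ioi 0)).trans_lt
    (ENNReal.mul_lt_top hg hh)

/-! ### Poincaré series of a discrete subgroup -/

theorem cosh_add_le (x t : ℝ) : Real.cosh (x + t) ≤ Real.exp |t| * Real.cosh x := by
  have hpos : Real.exp (x + t) ≤ Real.exp |t| * Real.exp x := by
    rw [Real.exp_add, mul_comm]
    gcongr
    exact le_abs_self t
  have hneg : Real.exp (-(x + t)) ≤ Real.exp |t| * Real.exp (-x) := by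
    rw [neg_add_rev, Real.exp_add]
    gcongr
    exact neg_le_abs t
  rw [Real.cosh_eq, Real.cosh_eq]
  linarith

theorem cosh_dist_rpow_neg_le {X : Type*} [PseudoMetricSpace X] {σ : ℝ} (hσ : 0 ≤ σ)
    {r : ℝ} {x y x' y' : X} (h : dist x x' + dist y y' ≤ r) :
    Real.cosh (dist x y) ^ (-σ) ≤ Real.exp (r * σ) * Real.cosh (dist x' y') ^ (-σ) := by
  have hdist : |dist x' y' - dist x y| ≤ r := by
    rw [abs_sub_comm, ← Real.dist_eq]
    exact (dist_dist_dist_le x y x' y').trans h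
  have hcosh : Real.cosh (dist x' y') ≤ Real.exp r * Real.cosh (dist x y) := by
    have := cosh_add_le (dist x y) (dist x' y' - dist x y)
    rw [add_sub_cancel] at this
    exact this.trans (by gcongr)
  have hrpow : (Real.exp r * Real.cosh (dist x y)) ^ (-σ) ≤ Real.cosh (dist x' y') ^ (-σ) :=
    Real.rpow_le_rpow_of_nonpos (Real.cosh_pos _) hcosh (neg_nonpos.mpr hσ)
  rw [Real.mul_rpow (Real.exp_pos _).le (Real.cosh_pos _).le, ← Real.exp_mul, mul_neg,
    Real.exp_neg, inv_mul_le_iff₀ (Real.exp_pos _)] at hrpow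
  exact hrpow

instance {G X : Type*} [Group G] [PseudoEMetricSpace X] [MulAction G X] [IsIsometricSMul G X]
    (H : Subgroup G) : IsIsometricSMul H X :=
  ⟨fun g => isometry_smul X (g : G)⟩

section Poincare

variable (Λ : Subgroup SL(2, ℝ)) [DiscreteTopology Λ] {σ : ℝ}

theorem exists_tsum_ofReal_cosh_dist_smul_le (hσ : 1 < σ) (w : ℍ) :
    ∃ B : NNReal, ∀ z : ℍ,
      ∑' γ : Λ, ENNReal.ofReal (Real.cosh (dist z (γ • w)) ^ (-σ)) ≤ B := by
  set N := {γ : Λ | dist w (γ • w) ≤ 2 * 1}.encard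
  set T := ∫⁻ u : ℍ, ENNReal.ofReal (Real.cosh (dist I u) ^ (-σ))
  set C := ENNReal.ofReal (Real.exp (1 * σ))
  have hball_pos : volume (Metric.ball w 1) ≠ 0 := (Metric.measure_ball_pos _ _ one_pos).ne'
  have hball_top : volume (Metric.ball w 1) ≠ ⊤ := measure_ball_lt_top.ne
  have hN : (N : ENNReal) ≠ ⊤ :=
    ENat.toENNReal_ne_top.mpr (finite_setOf_dist_smul_le w w _).encard_lt_top.ne
  have hT : T ≠ ⊤ := (lintegral_cosh_dist_rpow_lt_top hσ I).ne
  have hB : C * (N * T) / volume (Metric.ball w 1) ≠ ⊤ :=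
    ENNReal.div_ne_top (by finiteness) hball_pos
  refine ⟨(C * (N * T) / volume (Metric.ball w 1)).toNNReal, fun z => ?_⟩
  rw [ENNReal.coe_toNNReal hB, ENNReal.le_div_iff_mul_le (.inl hball_pos) (.inl hball_top)]
  refine (tsum_smul_mul_measure_ball_le
    (h := fun u => ENNReal.ofReal (Real.cosh (dist z u) ^ (-σ))) (C := C) (r := 1)
    (by fun_prop) (fun u v huv => ?_) w).trans_eq ?_
  · rw [← ENNReal.ofReal_mul (by positivity)]
    exact ENNReal.ofReal_le_ofReal
      (cosh_dist_rpow_neg_le (by linarith) (by rw [dist_self, zero_add]; exact huv.le))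
  · rw [lintegral_comp_dist_eq (G := SL(2, ℝ)) (fun d => ENNReal.ofReal (Real.cosh d ^ (-σ))) z I]

theorem summable_cosh_dist_smul (hσ : 1 < σ) (z w : ℍ) :
    Summable fun γ : Λ => Real.cosh (dist z (γ • w)) ^ (-σ) := by
  obtain ⟨B, hB⟩ := exists_tsum_ofReal_cosh_dist_smul_le Λ hσ w
  refine (ENNReal.summable_toReal ((hB z).trans_lt ENNReal.coe_lt_top).ne).congr fun γ => ?_
  exact ENNReal.toReal_ofReal (by positivity)

theorem exists_tsum_cosh_dist_smul_le (hσ : 1 < σ) (w : ℍ) :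
    ∃ B : ℝ, ∀ z : ℍ, ∑' γ : Λ, Real.cosh (dist z (γ • w)) ^ (-σ) ≤ B := by
  obtain ⟨B, hB⟩ := exists_tsum_ofReal_cosh_dist_smul_le Λ hσ w
  refine ⟨B, fun z => ?_⟩
  have := hB z
  rw [← ENNReal.ofReal_tsum_of_nonneg (fun γ => by positivity)
    (summable_cosh_dist_smul Λ hσ z w)] at this
  exact_mod_cast ENNReal.ofReal_le_coe.mp this

end Poincare

/-! ### Locally uniform bounds for the hypergeometric function -/

section Hypergeometric

theorem one_le_ordinaryHypergeometricSeries_radius (a b c : ℂ) :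
    1 ≤ (ordinaryHypergeometricSeries ℂ a b c).radius := by
  by_cases h : ∀ m : ℕ, (m : ℂ) ≠ -a ∧ (m : ℂ) ≠ -b ∧ (m : ℂ) ≠ -c
  · exact (ordinaryHypergeometricSeries_radius_eq_one ℂ a b c h).ge
  suffices h_top : (ordinaryHypergeometricSeries ℂ a b c).radius = ⊤ from h_top ▸ le_top
  obtain ⟨m, hm⟩ : ∃ m : ℕ, a = -m ∨ b = -m ∨ c = -m := by
    simp only [not_forall, not_and_or, not_not, eq_neg_iff_add_eq_zero] at h ⊢
    simpa only [add_comm] using h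
  obtain rfl | rfl | rfl := hm
  · exact ordinaryHypergeometric_radius_top_of_neg_nat₁ ℂ b c
  · exact ordinaryHypergeometric_radius_top_of_neg_nat₂ ℂ a c
  · exact ordinaryHypergeometric_radius_top_of_neg_nat₃ ℂ a b

theorem ascPochhammer_eval_le_norm {r : ℝ} (hr : 0 < r) {c : ℂ} (hc : r ≤ c.re) (n : ℕ) :
    (ascPochhammer ℝ n).eval r ≤ ‖(ascPochhammer ℂ n).eval c‖ := by
  induction n with
  | zero => simp
  | succ n ih =>
    rw [ascPochhammer_succ_eval, ascPochhammer_succ_eval, norm_mul]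
    have hre : r + n ≤ ‖c + n‖ := by
      refine le_trans ?_ (Complex.re_le_norm _)
      simpa using hc
    gcongr

theorem ascPochhammer_eval_ne_zero {c : ℂ} (hc : 0 < c.re) (n : ℕ) :
    (ascPochhammer ℂ n).eval c ≠ 0 :=
  norm_pos_iff.mp ((ascPochhammer_pos n c.re hc).trans_le (ascPochhammer_eval_le_norm hc le_rfl n))

theorem norm_ordinaryHypergeometricCoefficient_le (a b : ℂ) {r : ℝ} (hr : 0 < r) {c : ℂ}
    (hc : r ≤ c.re) (n : ℕ) :
    ‖ordinaryHypergeometricCoefficient a b c n‖ ≤ ‖ordinaryHypergeometricCoefficient a b r n‖ := by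
  have hpos := ascPochhammer_pos n r hr
  have heval : ‖(ascPochhammer ℂ n).eval (r : ℂ)‖ = (ascPochhammer ℝ n).eval r := by
    rw [← ascPochhammer_map Complex.ofRealHom, ← Complex.ofRealHom_eq_coe,
      Polynomial.eval_map_apply, Complex.ofRealHom_eq_coe, Complex.norm_real,
      Real.norm_of_nonneg hpos.le]
  simp only [norm_mul, norm_inv, heval]
  gcongr
  exact ascPochhammer_eval_le_norm hr hc n

/-- The `n`-th term of a convergent series which dominates the hypergeometric series
`F(a, b; c; x)` uniformly in `r ≤ Re c` and `|x| ≤ ρ`, where `0 < r` and `0 ≤ ρ < 1`. -/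
def hypergeometricMajorant (a b : ℂ) (r ρ : ℝ) (n : ℕ) : ℝ :=
  ‖ordinaryHypergeometricCoefficient a b (r : ℂ) n‖ * ρ ^ n

variable {a b c x : ℂ} {r ρ : ℝ}

theorem summable_hypergeometricMajorant (a b : ℂ) (r : ℝ) (hρ₀ : 0 ≤ ρ) (hρ₁ : ρ < 1) :
    Summable (hypergeometricMajorant a b r ρ) := by
  have hmem : (ρ : ℂ) ∈ Metric.eball 0 (ordinaryHypergeometricSeries ℂ a b (r : ℂ)).radius := by
    refine Metric.eball_subset_eball (one_le_ordinaryHypergeometricSeries_radius a b r) ?_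
    rw [Metric.mem_eball, edist_zero_right, ← ofReal_norm, ENNReal.ofReal_lt_one,
      Complex.norm_real, Real.norm_of_nonneg hρ₀]
    exact hρ₁
  refine (FormalMultilinearSeries.summable_norm_apply _ hmem).congr fun n => ?_
  rw [ordinaryHypergeometricSeries_apply_eq, norm_smul, norm_pow, Complex.norm_real,
    Real.norm_of_nonneg hρ₀, hypergeometricMajorant]

theorem tsum_hypergeometricMajorant_nonneg (a b : ℂ) (r : ℝ) (hρ : 0 ≤ ρ) :
    0 ≤ ∑' n, hypergeometricMajorant a b r ρ n :=
  tsum_nonneg fun _ => mul_nonneg (norm_nonneg _) (pow_nonneg hρ _)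

theorem norm_ordinaryHypergeometric_term_le (a b : ℂ) (hr : 0 < r) (hc : r ≤ c.re) (hx : ‖x‖ ≤ ρ)
    (n : ℕ) :
    ‖ordinaryHypergeometricCoefficient a b c n • x ^ n‖ ≤ hypergeometricMajorant a b r ρ n := by
  rw [norm_smul, norm_pow, hypergeometricMajorant]
  gcongr ?_ * ?_ ^ n
  exact norm_ordinaryHypergeometricCoefficient_le a b hr hc n

theorem norm_ordinaryHypergeometric_le (a b : ℂ) (hr : 0 < r) (hc : r ≤ c.re) (hx : ‖x‖ ≤ ρ)
    (hρ : ρ < 1) :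
    ‖ordinaryHypergeometric a b c x‖ ≤ ∑' n, hypergeometricMajorant a b r ρ n := by
  rw [ordinaryHypergeometric_eq_tsum]
  exact tsum_of_norm_bounded
    (summable_hypergeometricMajorant a b r ((norm_nonneg x).trans hx) hρ).hasSum
    (norm_ordinaryHypergeometric_term_le a b hr hc hx)

theorem continuousOn_ordinaryHypergeometric (a b : ℂ) (hc : 0 < c.re) :
    ContinuousOn (ordinaryHypergeometric a b c) (Metric.ball (0 : ℂ) 1) := by
  intro x hx
  obtain ⟨ρ, hxρ, hρ⟩ := exists_between (mem_ball_zero_iff.mp hx)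
  have hcont : ContinuousOn (ordinaryHypergeometric a b c) (Metric.closedBall (0 : ℂ) ρ) := by
    rw [ordinaryHypergeometric_eq_tsum]
    refine continuousOn_tsum (fun n => by fun_prop)
      (summable_hypergeometricMajorant a b c.re ((norm_nonneg x).trans hxρ.le) hρ) fun n y hy => ?_
    exact norm_ordinaryHypergeometric_term_le a b hc le_rfl (mem_closedBall_zero_iff.mp hy) n
  exact (hcont.continuousAt (Metric.closedBall_mem_nhds_of_mem
    (mem_ball_zero_iff.mpr hxρ))).continuousWithinAt

theorem differentiableOn_ordinaryHypergeometric (a b : ℂ) (hx : ‖x‖ < 1) :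
    DifferentiableOn ℂ (fun c => ordinaryHypergeometric a b c x) {c : ℂ | 0 < c.re} := by
  intro c hc
  obtain ⟨r, hr, hrc⟩ := exists_between (show 0 < c.re from hc)
  have hopen : IsOpen {c : ℂ | r < c.re} := isOpen_lt continuous_const Complex.continuous_re
  have hdiff : DifferentiableOn ℂ (fun c => ordinaryHypergeometric a b c x) {c | r < c.re} := by
    simp_rw [ordinaryHypergeometric_eq_tsum]
    refine Complex.differentiableOn_tsum_of_summable_norm
      (summable_hypergeometricMajorant a b r (norm_nonneg x) hx) (fun n => ?_) hopen
      fun n s hs => norm_ordinaryHypergeometric_term_le a b hr (le_of_lt hs) le_rfl n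
    refine DifferentiableOn.smul_const (DifferentiableOn.const_mul ?_ _) _
    exact (ascPochhammer ℂ n).differentiable.differentiableOn.inv
      fun s hs => ascPochhammer_eval_ne_zero (hr.trans hs) n
  exact (hdiff.differentiableAt (hopen.mem_nhds hrc)).differentiableWithinAt

end Hypergeometric

/-! ### The factors of absolute value one -/

theorem arg_mem_Ioo_of_im_pos {u : ℂ} (hu : 0 < u.im) : u.arg ∈ Set.Ioo 0 Real.pi := by
  refine ⟨(Complex.arg_nonneg_iff.mpr hu.le).lt_of_ne fun h => ?_,
    Complex.arg_lt_pi_iff.mpr (.inr hu.ne')⟩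
  exact hu.ne' (Complex.arg_eq_zero_iff.mp h.symm).2

theorem im_sub_conj_pos (z w : ℍ) : 0 < ((z : ℂ) - (starRingEnd ℂ) (w : ℂ)).im := by
  simpa using add_pos z.im_pos w.im_pos

theorem sub_conj_ne_zero (z w : ℍ) : (z : ℂ) - (starRingEnd ℂ) (w : ℂ) ≠ 0 := fun h =>
  (im_sub_conj_pos z w).ne' (by rw [h, Complex.zero_im])

theorem neg_norm_sq_div_sq_eq_exp {u : ℂ} (hu : u ≠ 0) :
    -((‖u‖ : ℂ) ^ 2 / u ^ 2) =
      Complex.exp (((Real.pi - 2 * u.arg : ℝ) : ℂ) * Complex.I) := by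
  have hpolar : u ^ 2 = (‖u‖ : ℂ) ^ 2 * Complex.exp (2 * (u.arg * Complex.I)) := by
    conv_lhs => rw [← Complex.norm_mul_exp_arg_mul_I u, mul_pow, ← Complex.exp_nat_mul]
    norm_num
  have hsplit : ((Real.pi - 2 * u.arg : ℝ) : ℂ) * Complex.I =
      Real.pi * Complex.I - 2 * (u.arg * Complex.I) := by
    push_cast
    ring
  have hnorm : (‖u‖ : ℂ) ^ 2 ≠ 0 := by simpa using hu
  rw [hsplit, Complex.exp_sub, Complex.exp_pi_mul_I, hpolar, div_mul_eq_div_div, div_self hnorm,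
    neg_div]

theorem H_eq_exp (k : ℝ) (z w : ℍ) :
    H k z w = Complex.exp
      (Complex.I * k * (Real.pi - 2 * ((z : ℂ) - (starRingEnd ℂ) (w : ℂ)).arg)) := by
  have harg := arg_mem_Ioo_of_im_pos (im_sub_conj_pos z w)
  rw [H, neg_norm_sq_div_sq_eq_exp (sub_conj_ne_zero z w),
    Complex.cpow_def_of_ne_zero (Complex.exp_ne_zero _), Complex.log_exp]
  · push_cast
    ring_nf
  · rw [Complex.im_ofReal_mul, Complex.I_im]
    linarith [harg.2]
  · rw [Complex.im_ofReal_mul, Complex.I_im]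
    linarith [harg.1]

theorem norm_H (k : ℝ) (z w : ℍ) : ‖H k z w‖ = 1 := by
  rw [H_eq_exp, Complex.norm_exp]
  simp

theorem norm_J (k : ℝ) (γ : SL(2, ℝ)) (z : ℍ) : ‖J k γ z‖ = 1 := by
  rw [J, Complex.norm_exp]
  simp

theorem continuous_H_left (k : ℝ) (w : ℍ) : Continuous fun z => H k z w := by
  have harg : Continuous fun z : ℍ => ((z : ℂ) - (starRingEnd ℂ) (w : ℂ)).arg := by
    refine continuous_iff_continuousAt.mpr fun z => ?_
    exact (Complex.continuousAt_arg (.inr (im_sub_conj_pos z w).ne')).comp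
      (f := fun z : ℍ => (z : ℂ) - (starRingEnd ℂ) (w : ℂ)) (by fun_prop)
  simp_rw [H_eq_exp]
  fun_prop

/-! ### Normal convergence -/

section NormalConvergence

theorem norm_inv_one_add_cosh_le (d : ℝ) : ‖(((1 + Real.cosh d)⁻¹ : ℝ) : ℂ)‖ ≤ 1 / 2 := by
  have := Real.one_le_cosh d
  rw [Complex.norm_real, Real.norm_of_nonneg (by positivity), one_div]
  gcongr
  linarith

theorem norm_inv_one_add_cosh_lt_one (d : ℝ) : ‖(((1 + Real.cosh d)⁻¹ : ℝ) : ℂ)‖ < 1 :=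
  (norm_inv_one_add_cosh_le d).trans_lt one_half_lt_one

variable {V : Type*} [NormedAddCommGroup V] [InnerProductSpace ℂ V]

theorem toEnd_apply (u : V ≃ₗᵢ[ℂ] V) (v : V) : toEnd u v = u v := rfl

theorem norm_toEnd_le (u : V ≃ₗᵢ[ℂ] V) : ‖toEnd u‖ ≤ 1 :=
  u.toLinearIsometry.norm_toContinuousLinearMap_le

variable (Γ : Subgroup PSL2R) (k : ℝ) (χ : cover Γ → (V ≃ₗᵢ[ℂ] V))

theorem norm_term_le (γ : cover Γ) {s : ℂ} (hs : 1 ≤ s.re) (z w : ℍ) :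
    ‖term Γ k χ γ s z w‖ ≤
      (∑' n, hypergeometricMajorant (-k) k 1 (1 / 2) n) *
        Real.cosh (dist z (γ • w)) ^ (-s.re) := by
  have hF := norm_ordinaryHypergeometric_le (-k : ℂ) k one_pos hs
    (norm_inv_one_add_cosh_le (dist z (γ • w))) one_half_lt_one
  change ‖(_ : ℂ) • toEnd (χ γ)‖ ≤ _
  rw [norm_smul, norm_mul, norm_mul, norm_mul, norm_H, norm_J,
    Complex.norm_cpow_eq_rpow_re_of_pos (Real.cosh_pos _), Complex.neg_re, mul_one, mul_one]
  refine (mul_le_of_le_one_right (by positivity) (norm_toEnd_le _)).trans ?_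
  rw [mul_comm]
  exact mul_le_mul_of_nonneg_right hF (by positivity)

theorem continuous_term_left (γ : cover Γ) {s : ℂ} (hs : 0 < s.re) (w : ℍ) :
    Continuous fun z => term Γ k χ γ s z w := by
  have hcosh : Continuous fun z : ℍ => Real.cosh (dist z ((γ : SL(2, ℝ)) • w)) := by fun_prop
  have hpow : Continuous fun z : ℍ =>
      (Real.cosh (dist z ((γ : SL(2, ℝ)) • w)) : ℂ) ^ (-s) :=
    (Complex.continuous_ofReal.comp hcosh).cpow continuous_const
      fun z => .inl (by simpa using Real.cosh_pos _)
  have hF : Continuous fun z : ℍ => ordinaryHypergeometric (-(k : ℂ)) (k : ℂ) s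
      (((1 + Real.cosh (dist z ((γ : SL(2, ℝ)) • w)))⁻¹ : ℝ) : ℂ) := by
    refine (continuousOn_ordinaryHypergeometric (-k : ℂ) k hs).comp_continuous ?_ fun z => ?_
    · exact Complex.continuous_ofReal.comp ((continuous_const.add hcosh).inv₀ fun z =>
        (add_pos one_pos (Real.cosh_pos _)).ne')
    · exact mem_ball_zero_iff.mpr (norm_inv_one_add_cosh_lt_one _)
  exact (((hpow.mul hF).mul continuous_const).mul (continuous_H_left k _)).smul continuous_const

theorem differentiableOn_term (γ : cover Γ) (z w : ℍ) :
    DifferentiableOn ℂ (fun s => term Γ k χ γ s z w) {s : ℂ | 0 < s.re} := by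
  have hpow : Differentiable ℂ fun s : ℂ =>
      (Real.cosh (dist z ((γ : SL(2, ℝ)) • w)) : ℂ) ^ (-s) :=
    differentiable_id.neg.const_cpow (.inl (by exact_mod_cast (Real.cosh_pos _).ne'))
  exact (((hpow.differentiableOn.mul (differentiableOn_ordinaryHypergeometric (-k : ℂ) k
    (norm_inv_one_add_cosh_lt_one _))).mul_const _).mul_const _).smul_const _

variable [DiscreteTopology Γ]

theorem exists_summable_norm_term_le {C : Set (ℍ × ℍ)} (hC : IsCompact C) {σ : ℝ} (hσ : 1 < σ) :
    ∃ M : cover Γ → ℝ, Summable M ∧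
      ∀ γ, ∀ p ∈ C, ∀ s : ℂ, σ ≤ s.re → ‖term Γ k χ γ s p.1 p.2‖ ≤ M γ := by
  obtain ⟨R, hR⟩ := (hC.image (f := fun p : ℍ × ℍ => dist p.1 I + dist p.2 I)
    (by fun_prop)).bddAbove
  refine ⟨fun γ => (∑' n, hypergeometricMajorant (-k) k 1 (1 / 2) n) *
    (Real.exp (R * σ) * Real.cosh (dist I (γ • I)) ^ (-σ)),
    ((summable_cosh_dist_smul (cover Γ) hσ I I).mul_left _).mul_left _, fun γ p hp s hs => ?_⟩
  have hdist : dist p.1 I + dist (γ • p.2) (γ • I) ≤ R := by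
    rw [dist_smul]
    exact hR ⟨p, hp, rfl⟩
  refine (norm_term_le Γ k χ γ (hσ.le.trans hs) p.1 p.2).trans
    (mul_le_mul_of_nonneg_left ?_
      (tsum_hypergeometricMajorant_nonneg _ _ _ one_half_pos.le))
  calc Real.cosh (dist p.1 (γ • p.2)) ^ (-s.re)
      ≤ Real.cosh (dist p.1 (γ • p.2)) ^ (-σ) :=
        Real.rpow_le_rpow_of_exponent_le (Real.one_le_cosh _) (neg_le_neg hs)
    _ ≤ Real.exp (R * σ) * Real.cosh (dist I (γ • I)) ^ (-σ) :=
        cosh_dist_rpow_neg_le (by linarith) hdist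

theorem exists_norm_kernelSum_le {s : ℂ} (hs : 1 < s.re) (w : ℍ) :
    ∃ B : ℝ, ∀ z, ‖kernelSum Γ k χ s z w‖ ≤ B := by
  obtain ⟨B, hB⟩ := exists_tsum_cosh_dist_smul_le (cover Γ) hs w
  refine ⟨(∑' n, hypergeometricMajorant (-k) k 1 (1 / 2) n) * B, fun z => ?_⟩
  refine (tsum_of_norm_bounded ((summable_cosh_dist_smul (cover Γ) hs z w).mul_left _).hasSum
    fun γ => norm_term_le Γ k χ γ hs.le z w).trans ?_
  rw [tsum_mul_left]
  exact mul_le_mul_of_nonneg_left (hB z)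
    (tsum_hypergeometricMajorant_nonneg _ _ _ one_half_pos.le)

variable [CompleteSpace V]

theorem summable_term {s : ℂ} (hs : 1 < s.re) (z w : ℍ) :
    Summable fun γ => term Γ k χ γ s z w := by
  obtain ⟨M, hM, hle⟩ :=
    exists_summable_norm_term_le Γ k χ (isCompact_singleton (x := (z, w))) hs
  exact .of_norm_bounded hM fun γ => hle γ _ rfl s le_rfl

theorem hasSumUniformlyOn_term {C : Set (ℍ × ℍ)} (hC : IsCompact C) {σ : ℝ} (hσ : 1 < σ) :
    HasSumUniformlyOn (fun γ (q : (ℍ × ℍ) × ℂ) => term Γ k χ γ q.2 q.1.1 q.1.2)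
      (fun q => kernelSum Γ k χ q.2 q.1.1 q.1.2) (C ×ˢ {s : ℂ | σ ≤ s.re}) := by
  obtain ⟨M, hM, hle⟩ := exists_summable_norm_term_le Γ k χ hC hσ
  exact HasSumUniformlyOn.of_norm_le_summable hM fun γ q hq => hle γ q.1 hq.1 q.2 hq.2

theorem differentiableOn_kernelSum (z w : ℍ) :
    DifferentiableOn ℂ (fun s => kernelSum Γ k χ s z w) {s : ℂ | 1 < s.re} := by
  intro s₀ hs₀
  obtain ⟨σ, hσ, hσs⟩ := exists_between (show 1 < s₀.re from hs₀)
  obtain ⟨M, hM, hle⟩ :=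
    exists_summable_norm_term_le Γ k χ (isCompact_singleton (x := (z, w))) hσ
  have hopen : IsOpen {s : ℂ | σ < s.re} := isOpen_lt continuous_const Complex.continuous_re
  have hdiff := Complex.differentiableOn_tsum_of_summable_norm hM
    (fun γ => (differentiableOn_term Γ k χ γ z w).mono
      fun s hs => (zero_lt_one.trans hσ).trans hs)
    hopen fun γ s hs => hle γ _ rfl s (le_of_lt hs)
  exact (hdiff.differentiableAt (hopen.mem_nhds hσs)).differentiableWithinAt

theorem analyticAt_kernelSum {s : ℂ} (hs : 1 < s.re) (z w : ℍ) :
    AnalyticAt ℂ (fun s => kernelSum Γ k χ s z w) s :=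
  (differentiableOn_kernelSum Γ k χ z w).analyticAt
    ((isOpen_lt continuous_const Complex.continuous_re).mem_nhds hs)

theorem continuous_kernelSum_left {s : ℂ} (hs : 1 < s.re) (w : ℍ) :
    Continuous fun z => kernelSum Γ k χ s z w := by
  refine continuous_iff_continuousAt.mpr fun z₀ => ?_
  obtain ⟨M, hM, hle⟩ := exists_summable_norm_term_le Γ k χ
    ((isCompact_closedBall z₀ 1).prod (isCompact_singleton (x := w))) hs
  have hcont : ContinuousOn (fun z => kernelSum Γ k χ s z w) (Metric.closedBall z₀ 1) :=
    continuousOn_tsum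
      (fun γ => (continuous_term_left Γ k χ γ (zero_lt_one.trans hs) w).continuousOn) hM
      fun γ z hz => hle γ (z, w) ⟨hz, rfl⟩ s le_rfl
  exact hcont.continuousAt (Metric.closedBall_mem_nhds z₀ one_pos)

end NormalConvergence

/-! ### Automorphy -/

section Automorphy

theorem j_ne_zero (γ : SL(2, ℝ)) (z : ℍ) : j γ z ≠ 0 :=
  denom_ne_zero γ z

theorem coe_smul_eq_div_j (γ : SL(2, ℝ)) (z : ℍ) :
    ((γ • z : ℍ) : ℂ) = ((γ 0 0 : ℂ) * z + γ 0 1) / j γ z :=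
  coe_specialLinearGroup_apply γ z

theorem j_mul (γ δ : SL(2, ℝ)) (z : ℍ) : j (γ * δ) z = j γ (δ • z) * j δ z := by
  rw [j.eq_def γ, coe_smul_eq_div_j]
  exact denom_cocycle γ δ z.im_ne_zero

theorem im_j (γ : SL(2, ℝ)) (z : ℍ) : (j γ z).im = γ 1 0 * z.im := by
  simp [j]

theorem smul_sub_conj_smul (γ : SL(2, ℝ)) (z u : ℍ) :
    ((γ • z : ℍ) : ℂ) - (starRingEnd ℂ) ((γ • u : ℍ) : ℂ) =
      ((z : ℂ) - (starRingEnd ℂ) (u : ℂ)) / (j γ z * (starRingEnd ℂ) (j γ u)) := by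
  have hz : j γ z ≠ 0 := j_ne_zero γ z
  have hu : (starRingEnd ℂ) (j γ u) ≠ 0 := (map_ne_zero _).mpr (j_ne_zero γ u)
  have hdet : (γ 0 0 : ℂ) * γ 1 1 - (γ 0 1 : ℂ) * γ 1 0 = 1 := by
    exact_mod_cast (Matrix.det_fin_two _).symm.trans γ.det_coe
  rw [coe_smul_eq_div_j, coe_smul_eq_div_j, map_div₀]
  field_simp
  simp only [j, map_add, map_mul, Complex.conj_ofReal]
  linear_combination ((z : ℂ) - (starRingEnd ℂ) (u : ℂ)) * hdet

theorem continuous_arg_j (γ : SL(2, ℝ)) : Continuous fun z : ℍ => (j γ z).arg := by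
  by_cases hc : γ 1 0 = 0
  · simp only [j, hc, Complex.ofReal_zero, zero_mul, zero_add]
    exact continuous_const
  · refine continuous_iff_continuousAt.mpr fun z => ?_
    refine (Complex.continuousAt_arg (.inr ?_)).comp (f := fun z : ℍ => j γ z) ?_
    · rw [im_j]
      exact mul_ne_zero hc z.im_ne_zero
    · unfold j
      fun_prop

theorem abs_arg_j_sub_lt (γ : SL(2, ℝ)) (z u : ℍ) :
    |(j γ z).arg - (j γ u).arg| < Real.pi := by
  rw [abs_lt]
  rcases lt_trichotomy (γ 1 0) 0 with hc | hc | hc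
  · have harg (z : ℍ) : (j γ z).arg ∈ Set.Ioo (-Real.pi) 0 :=
      ⟨Complex.neg_pi_lt_arg _, Complex.arg_neg_iff.mpr
        (by rw [im_j]; exact mul_neg_of_neg_of_pos hc z.im_pos)⟩
    constructor <;> linarith [(harg z).1, (harg z).2, (harg u).1, (harg u).2]
  · have hconst : j γ z = j γ u := by simp [j, hc]
    rw [hconst, sub_self]
    exact ⟨neg_neg_of_pos Real.pi_pos, Real.pi_pos⟩
  · have harg (z : ℍ) : (j γ z).arg ∈ Set.Ioo 0 Real.pi :=
      arg_mem_Ioo_of_im_pos (by rw [im_j]; exact mul_pos hc z.im_pos)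
    constructor <;> linarith [(harg z).1, (harg z).2, (harg u).1, (harg u).2]

theorem eq_of_continuous_of_mem_range_intCast {X : Type*} [TopologicalSpace X]
    [PreconnectedSpace X] {f : X → ℝ} (hf : Continuous f) (hint : ∀ x, ∃ m : ℤ, (m : ℝ) = f x)
    (x y : X) : f x = f y :=
  isPreconnected_univ.constant_of_mapsTo
    Int.isClosedEmbedding_coe_real.isEmbedding.isDiscrete_range hf.continuousOn
    (fun x _ => hint x) (Set.mem_univ x) (Set.mem_univ y)

theorem two_pi_mul_wFactor (γ δ : SL(2, ℝ)) (z : ℍ) :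
    2 * Real.pi * wFactor γ δ =
      (j γ (δ • z)).arg + (j δ z).arg - (j (γ * δ) z).arg := by
  set f : ℍ → ℝ := fun z =>
    ((j γ (δ • z)).arg + (j δ z).arg - (j (γ * δ) z).arg) / (2 * Real.pi)
  have hf : Continuous f :=
    ((((continuous_arg_j γ).comp (continuous_const_smul δ)).add (continuous_arg_j δ)).sub
      (continuous_arg_j (γ * δ))).div_const _
  have hint (z : ℍ) : ∃ m : ℤ, (m : ℝ) = f z := by
    have hangle : (((j γ (δ • z)).arg + (j δ z).arg : ℝ) : Real.Angle) = (j (γ * δ) z).arg := by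
      rw [j_mul, Complex.arg_mul_coe_angle (j_ne_zero _ _) (j_ne_zero _ _), Real.Angle.coe_add]
    obtain ⟨m, hm⟩ := Real.Angle.angle_eq_iff_two_pi_dvd_sub.mp hangle
    exact ⟨m, by rw [eq_div_iff Real.two_pi_pos.ne', hm, mul_comm]⟩
  have hwf : wFactor γ δ = f z := eq_of_continuous_of_mem_range_intCast hf hint I z
  rw [hwf, mul_div_cancel₀ _ Real.two_pi_pos.ne']

theorem omega_mul_J (k : ℝ) (γ δ : SL(2, ℝ)) (z : ℍ) :
    omega k γ δ * J k (γ * δ) z = J k γ (δ • z) * J k δ z := by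
  have hw : (2 * Real.pi * wFactor γ δ : ℂ) =
      (j γ (δ • z)).arg + (j δ z).arg - (j (γ * δ) z).arg := by
    exact_mod_cast two_pi_mul_wFactor γ δ z
  rw [omega, J, J, J, ← Complex.exp_add, ← Complex.exp_add]
  congr 1
  linear_combination (2 * Complex.I * k) * hw

theorem eq_of_angle_eq_of_abs_sub_lt {a b : ℝ} (h : (a : Real.Angle) = b)
    (hab : |a - b| < 2 * Real.pi) : a = b := by
  obtain ⟨m, hm⟩ := Real.Angle.angle_eq_iff_two_pi_dvd_sub.mp h
  rw [hm, abs_mul, abs_of_pos Real.two_pi_pos, mul_lt_iff_lt_one_right Real.two_pi_pos] at hab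
  have hm₀ : m = 0 := Int.abs_lt_one_iff.mp (by exact_mod_cast hab)
  rwa [hm₀, Int.cast_zero, mul_zero, sub_eq_zero] at hm

theorem arg_smul_sub_conj_smul (γ : SL(2, ℝ)) (z u : ℍ) :
    (((γ • z : ℍ) : ℂ) - (starRingEnd ℂ) ((γ • u : ℍ) : ℂ)).arg =
      ((z : ℂ) - (starRingEnd ℂ) (u : ℂ)).arg - (j γ z).arg + (j γ u).arg := by
  have hconj : (starRingEnd ℂ) (j γ u) ≠ 0 := (map_ne_zero _).mpr (j_ne_zero γ u)
  refine eq_of_angle_eq_of_abs_sub_lt ?_ ?_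
  · rw [smul_sub_conj_smul, Complex.arg_div_coe_angle (sub_conj_ne_zero z u)
      (mul_ne_zero (j_ne_zero γ z) hconj), Complex.arg_mul_coe_angle (j_ne_zero γ z) hconj,
      Complex.arg_conj_coe_angle, Real.Angle.coe_add, Real.Angle.coe_sub]
    abel
  · have h₀ := arg_mem_Ioo_of_im_pos (im_sub_conj_pos z u)
    have h₁ := arg_mem_Ioo_of_im_pos (im_sub_conj_pos (γ • z) (γ • u))
    have h₂ := abs_lt.mp (abs_arg_j_sub_lt γ z u)
    rw [abs_lt]
    constructor <;> linarith [h₀.1, h₀.2, h₁.1, h₁.2, h₂.1, h₂.2]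

theorem J_mul_H_smul_smul (k : ℝ) (γ : SL(2, ℝ)) (z u : ℍ) :
    J k γ u * H k (γ • z) (γ • u) = J k γ z * H k z u := by
  rw [H_eq_exp, H_eq_exp, arg_smul_sub_conj_smul, J, J, ← Complex.exp_add, ← Complex.exp_add]
  push_cast
  ring_nf

variable {V : Type*} [NormedAddCommGroup V] [InnerProductSpace ℂ V]
  {Γ : Subgroup PSL2R} {k : ℝ} {χ : cover Γ → (V ≃ₗᵢ[ℂ] V)}

theorem toEnd_mul (hχ : IsMultiplierSystem Γ k χ) (γ δ : cover Γ) :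
    toEnd (χ (γ * δ)) = omega k γ δ • (toEnd (χ γ)).comp (toEnd (χ δ)) :=
  ContinuousLinearMap.ext (hχ.map_mul γ δ)

theorem term_mul_smul (hχ : IsMultiplierSystem Γ k χ) (γ δ : cover Γ) (s : ℂ) (z w : ℍ) :
    term Γ k χ (γ * δ) s ((γ : SL(2, ℝ)) • z) w =
      J k γ z • (toEnd (χ γ)).comp (term Γ k χ δ s z w) := by
  have hfactor : omega k γ δ * J k (γ * δ) w *
      H k ((γ : SL(2, ℝ)) • z) ((γ : SL(2, ℝ)) • (δ : SL(2, ℝ)) • w) =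
      J k γ z * J k δ w * H k z ((δ : SL(2, ℝ)) • w) := by
    rw [omega_mul_J]
    linear_combination J k δ w * J_mul_H_smul_smul k γ z ((δ : SL(2, ℝ)) • w)
  rw [term, term, toEnd_mul hχ, ContinuousLinearMap.comp_smul, smul_smul, smul_smul,
    Subgroup.coe_mul, mul_smul (γ : SL(2, ℝ)) (δ : SL(2, ℝ)) w, dist_smul]
  congr 1
  linear_combination (Real.cosh (dist z ((δ : SL(2, ℝ)) • w)) : ℂ) ^ (-s)
    * ordinaryHypergeometric (-(k : ℂ)) (k : ℂ) s
        (((1 + Real.cosh (dist z ((δ : SL(2, ℝ)) • w)))⁻¹ : ℝ) : ℂ) * hfactor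

theorem kernelSum_smul (hχ : IsMultiplierSystem Γ k χ) {s : ℂ} {z w : ℍ}
    (hsum : Summable fun γ => term Γ k χ γ s z w) (γ : cover Γ) :
    kernelSum Γ k χ s ((γ : SL(2, ℝ)) • z) w =
      J k γ z • (toEnd (χ γ)).comp (kernelSum Γ k χ s z w) := by
  rw [kernelSum, ← (Equiv.mulLeft γ).tsum_eq]
  simp only [Equiv.coe_mulLeft, term_mul_smul hχ]
  exact ((((ContinuousLinearMap.compL ℂ V V V) (toEnd (χ γ))).hasSum hsum.hasSum).const_smul
    (J k γ z)).tsum_eq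

end Automorphy

/-! ### Poles of the Gamma factor -/

theorem analyticAt_Gamma {s : ℂ} (hs : ∀ m : ℕ, s ≠ -m) : AnalyticAt ℂ Complex.Gamma s := by
  have hinv : AnalyticAt ℂ (fun s => (Complex.Gamma s)⁻¹) s :=
    Complex.differentiable_one_div_Gamma.analyticAt s
  simpa only [inv_inv] using hinv.fun_inv (inv_ne_zero (Complex.Gamma_ne_zero hs))

theorem analyticAt_Gamma_of_re_pos {s : ℂ} (hs : 0 < s.re) : AnalyticAt ℂ Complex.Gamma s :=
  analyticAt_Gamma fun m hm => hs.not_ge (by simp [hm])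

open Topology in
theorem meromorphicOrderAt_Gamma_eq_add (s : ℂ) :
    meromorphicOrderAt Complex.Gamma s =
      meromorphicOrderAt (fun t => t⁻¹) s + meromorphicOrderAt Complex.Gamma (s + 1) := by
  have hne : ∀ᶠ t in 𝓝[≠] s, t ≠ 0 := by
    rcases eq_or_ne s 0 with rfl | hs
    · exact self_mem_nhdsWithin
    · exact eventually_ne_nhdsWithin hs
  have hrec : Complex.Gamma =ᶠ[𝓝[≠] s] (fun t => t⁻¹) * (Complex.Gamma ∘ (· + 1)) := by
    filter_upwards [hne] with t ht
    rw [Pi.mul_apply, Function.comp_apply, Complex.Gamma_add_one t ht, inv_mul_cancel_left₀ ht]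
  rw [meromorphicOrderAt_congr hrec, meromorphicOrderAt_mul (by fun_prop)
    ((Meromorphic.Gamma _).comp_analyticAt (by fun_prop)),
    meromorphicOrderAt_comp_add_const_eq_meromorphicOrderAt]

theorem meromorphicOrderAt_eq_zero_of_ne_zero {E : Type*} [NormedAddCommGroup E]
    [NormedSpace ℂ E] {g : ℂ → E} {x : ℂ} (hg : AnalyticAt ℂ g x) (hgx : g x ≠ 0) :
    meromorphicOrderAt g x = 0 := by
  rw [hg.meromorphicOrderAt_eq, hg.analyticOrderAt_eq_zero.mpr hgx]
  rfl

theorem meromorphicOrderAt_Gamma_neg_nat (n : ℕ) :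
    meromorphicOrderAt Complex.Gamma (-(n : ℂ)) = -1 := by
  induction n with
  | zero =>
    have hid : meromorphicOrderAt (fun t : ℂ => t⁻¹) 0 = -1 := by
      rw [← meromorphicOrderAt_id (𝕜 := ℂ), ← meromorphicOrderAt_inv]
      rfl
    rw [meromorphicOrderAt_Gamma_eq_add, Nat.cast_zero, neg_zero, zero_add, hid,
      meromorphicOrderAt_eq_zero_of_ne_zero (analyticAt_Gamma_of_re_pos (by simp)) (by simp),
      add_zero]
  | succ n ih =>
    have hn : -((n + 1 : ℕ) : ℂ) ≠ 0 := neg_ne_zero.mpr (Nat.cast_ne_zero.mpr n.succ_ne_zero)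
    have hshift : -((n + 1 : ℕ) : ℂ) + 1 = -n := by
      push_cast
      ring
    rw [meromorphicOrderAt_Gamma_eq_add, hshift, ih,
      meromorphicOrderAt_eq_zero_of_ne_zero (analyticAt_inv hn) (inv_ne_zero hn), zero_add]

theorem gammaFactor_neg (k : ℝ) : gammaFactor (-k) = gammaFactor k := by
  ext s
  rw [gammaFactor, gammaFactor, Complex.ofReal_neg, sub_neg_eq_add, ← sub_eq_add_neg,
    mul_comm (Complex.Gamma (s + k))]

/-- The cofactor of `Γ(s - |k|)` in the Gamma factor: on `Re s > 0` it is holomorphic without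
zeros, so that there the poles of the Gamma factor are those of `Γ(s - |k|)`. -/
def regularFactor (k : ℝ) (s : ℂ) : ℂ :=
  Complex.Gamma (s + |k|) / (Real.sqrt (2 * Real.pi) * Complex.Gamma s ^ 2)

theorem gammaFactor_eq_regularFactor_mul (k : ℝ) :
    gammaFactor k = regularFactor k * (Complex.Gamma ∘ (· - ((|k| : ℝ) : ℂ))) := by
  have habs : gammaFactor k = gammaFactor |k| := by
    rcases abs_choice k with h | h <;> rw [h]
    exact (gammaFactor_neg k).symm
  ext s
  rw [habs, gammaFactor, Pi.mul_apply, regularFactor, Function.comp_apply,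
    mul_comm (Complex.Gamma _), mul_div_right_comm]

theorem sqrt_two_pi_mul_Gamma_sq_ne_zero {s : ℂ} (hs : 0 < s.re) :
    (Real.sqrt (2 * Real.pi) : ℂ) * Complex.Gamma s ^ 2 ≠ 0 := by
  have hpi : (Real.sqrt (2 * Real.pi) : ℂ) ≠ 0 := by
    exact_mod_cast (Real.sqrt_pos.mpr Real.two_pi_pos).ne'
  exact mul_ne_zero hpi (pow_ne_zero 2 (Complex.Gamma_ne_zero_of_re_pos hs))

theorem re_add_abs_pos (k : ℝ) {s : ℂ} (hs : 0 < s.re) : 0 < (s + |k|).re := by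
  simpa only [Complex.add_re, Complex.ofReal_re] using add_pos_of_pos_of_nonneg hs (abs_nonneg k)

theorem regularFactor_ne_zero (k : ℝ) {s : ℂ} (hs : 0 < s.re) : regularFactor k s ≠ 0 :=
  div_ne_zero (Complex.Gamma_ne_zero_of_re_pos (re_add_abs_pos k hs))
    (sqrt_two_pi_mul_Gamma_sq_ne_zero hs)

theorem analyticAt_regularFactor (k : ℝ) {s : ℂ} (hs : 0 < s.re) :
    AnalyticAt ℂ (regularFactor k) s := by
  have hshift : AnalyticAt ℂ (fun s => Complex.Gamma (s + (|k| : ℝ))) s :=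
    (analyticAt_Gamma_of_re_pos (re_add_abs_pos k hs)).fun_comp (f := (· + ((|k| : ℝ) : ℂ)))
      (by fun_prop)
  exact hshift.div (analyticAt_const.mul ((analyticAt_Gamma_of_re_pos hs).pow 2))
    (sqrt_two_pi_mul_Gamma_sq_ne_zero hs)

theorem meromorphicAt_gammaFactor (k : ℝ) (s : ℂ) : MeromorphicAt (gammaFactor k) s := by
  have hsub : MeromorphicAt (fun s => Complex.Gamma (s - k)) s :=
    (Meromorphic.Gamma _).comp_analyticAt (by fun_prop)
  have hadd : MeromorphicAt (fun s => Complex.Gamma (s + k)) s :=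
    (Meromorphic.Gamma _).comp_analyticAt (by fun_prop)
  exact (hsub.mul hadd).div ((MeromorphicAt.const _ s).mul ((Meromorphic.Gamma s).pow 2))

theorem analyticAt_gammaFactor (k : ℝ) {s : ℂ} (hs : 0 < s.re)
    (h : ∀ n : ℕ, s ≠ ((|k| - n : ℝ) : ℂ)) : AnalyticAt ℂ (gammaFactor k) s := by
  rw [gammaFactor_eq_regularFactor_mul]
  refine (analyticAt_regularFactor k hs).mul
    ((analyticAt_Gamma fun n hn => h n ?_).fun_comp (by fun_prop))
  rw [Complex.ofReal_sub, Complex.ofReal_natCast, sub_eq_add_neg, ← hn, add_sub_cancel]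

theorem meromorphicOrderAt_gammaFactor (k : ℝ) {n : ℕ} (hn : 0 < |k| - n) :
    meromorphicOrderAt (gammaFactor k) ((|k| - n : ℝ) : ℂ) = -1 := by
  have hshift : ((|k| - n : ℝ) : ℂ) - |k| = -n := by
    push_cast
    ring
  rw [gammaFactor_eq_regularFactor_mul, meromorphicOrderAt_mul_of_ne_zero
    (analyticAt_regularFactor k hn) (regularFactor_ne_zero k hn),
    meromorphicOrderAt_comp_sub_const_eq_meromorphicOrderAt, hshift,
    meromorphicOrderAt_Gamma_neg_nat]

section SimplePole

variable {E : Type*} [NormedAddCommGroup E] [NormedSpace ℂ E] {f : ℂ → ℂ} {g : ℂ → E} {x : ℂ}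

theorem meromorphicOrderAt_smul_nonneg_of_eq_zero (hf : meromorphicOrderAt f x = -1)
    (hg : AnalyticAt ℂ g x) (hgx : g x = 0) : 0 ≤ meromorphicOrderAt (f • g) x := by
  have hf' : MeromorphicAt f x := meromorphicAt_of_meromorphicOrderAt_ne_zero (by simp [hf])
  have hone : 1 ≤ meromorphicOrderAt g x := by
    rw [hg.meromorphicOrderAt_eq]
    have h1 : 1 ≤ analyticOrderAt g x :=
      Order.one_le_iff_ne_zero.mpr fun h => hg.analyticOrderAt_eq_zero.mp h hgx
    exact ENat.monotone_map_iff.mpr Nat.mono_cast h1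
  rw [meromorphicOrderAt_smul hf' hg.meromorphicAt, hf]
  exact add_le_add_right hone (-1)

theorem meromorphicOrderAt_smul_eq_neg_one (hf : meromorphicOrderAt f x = -1)
    (hg : AnalyticAt ℂ g x) (hgx : g x ≠ 0) : meromorphicOrderAt (f • g) x = -1 := by
  have hf' : MeromorphicAt f x := meromorphicAt_of_meromorphicOrderAt_ne_zero (by simp [hf])
  rw [meromorphicOrderAt_smul hf' hg.meromorphicAt, hf,
    meromorphicOrderAt_eq_zero_of_ne_zero hg hgx, add_zero]

end SimplePole

/-! ### Poles of the automorphic kernel -/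

section Kernel

variable {V : Type*} [NormedAddCommGroup V] [InnerProductSpace ℂ V] [CompleteSpace V]
  (Γ : Subgroup PSL2R) [DiscreteTopology Γ] (k : ℝ) (χ : cover Γ → (V ≃ₗᵢ[ℂ] V))

theorem meromorphicOn_kernel (z w : ℍ) :
    MeromorphicOn (fun s => kernel Γ k χ s z w) {s : ℂ | 1 < s.re} := fun s hs =>
  (meromorphicAt_gammaFactor k s).smul (analyticAt_kernelSum Γ k χ hs z w).meromorphicAt

theorem analyticAt_kernel {s : ℂ} (hs : 1 < s.re) (h : ∀ n : ℕ, s ≠ ((|k| - n : ℝ) : ℂ))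
    (z w : ℍ) : AnalyticAt ℂ (fun s => kernel Γ k χ s z w) s :=
  (analyticAt_gammaFactor k (one_pos.trans hs) h).smul (analyticAt_kernelSum Γ k χ hs z w)

theorem meromorphicOrderAt_kernel_nonneg_of_kernelSum_eq_zero {n : ℕ} (hn : 1 < |k| - n)
    {z w : ℍ} (h : kernelSum Γ k χ ((|k| - n : ℝ) : ℂ) z w = 0) :
    0 ≤ meromorphicOrderAt (fun s => kernel Γ k χ s z w) ((|k| - n : ℝ) : ℂ) :=
  meromorphicOrderAt_smul_nonneg_of_eq_zero
    (meromorphicOrderAt_gammaFactor k (one_pos.trans hn)) (analyticAt_kernelSum Γ k χ hn z w) h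

theorem meromorphicOrderAt_kernel_eq_neg_one_of_kernelSum_ne_zero {n : ℕ} (hn : 1 < |k| - n)
    {z w : ℍ} (h : kernelSum Γ k χ ((|k| - n : ℝ) : ℂ) z w ≠ 0) :
    meromorphicOrderAt (fun s => kernel Γ k χ s z w) ((|k| - n : ℝ) : ℂ) = -1 :=
  meromorphicOrderAt_smul_eq_neg_one
    (meromorphicOrderAt_gammaFactor k (one_pos.trans hn)) (analyticAt_kernelSum Γ k χ hn z w) h

theorem meromorphicOrderAt_kernel_eq_neg_one_iff {n : ℕ} (hn : 1 < |k| - n) (z w : ℍ) :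
    meromorphicOrderAt (fun s => kernel Γ k χ s z w) ((|k| - n : ℝ) : ℂ) = -1 ↔
      kernelSum Γ k χ ((|k| - n : ℝ) : ℂ) z w ≠ 0 := by
  refine ⟨fun hpole h => ?_, meromorphicOrderAt_kernel_eq_neg_one_of_kernelSum_ne_zero Γ k χ hn⟩
  have hnonneg := meromorphicOrderAt_kernel_nonneg_of_kernelSum_eq_zero Γ k χ hn h
  rw [hpole] at hnonneg
  exact absurd hnonneg (by decide)

theorem exists_eq_abs_sub_natCast_of_meromorphicOrderAt_kernel_neg {s : ℂ} (hs : 1 < s.re)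
    {z w : ℍ} (h : meromorphicOrderAt (fun s => kernel Γ k χ s z w) s < 0) :
    ∃ n : ℕ, (n : ℝ) ≤ |k| - 1 ∧ s = ((|k| - n : ℝ) : ℂ) := by
  obtain ⟨n, rfl⟩ : ∃ n : ℕ, s = ((|k| - n : ℝ) : ℂ) := by
    by_contra! hne
    exact h.not_ge (analyticAt_kernel Γ k χ hs hne z w).meromorphicOrderAt_nonneg
  rw [Complex.ofReal_re] at hs
  exact ⟨n, by linarith, rfl⟩

theorem one_lt_abs_of_meromorphicOrderAt_kernel_neg {s : ℂ} (hs : 1 < s.re) {z w : ℍ}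
    (h : meromorphicOrderAt (fun s => kernel Γ k χ s z w) s < 0) : 1 < |k| := by
  obtain ⟨n, -, rfl⟩ := exists_eq_abs_sub_natCast_of_meromorphicOrderAt_kernel_neg Γ k χ hs h
  rw [Complex.ofReal_re] at hs
  linarith [n.cast_nonneg (α := ℝ)]

theorem meromorphicOrderAt_kernel_eq_neg_one_of_neg {s : ℂ} (hs : 1 < s.re) {z w : ℍ}
    (h : meromorphicOrderAt (fun s => kernel Γ k χ s z w) s < 0) :
    meromorphicOrderAt (fun s => kernel Γ k χ s z w) s = -1 := by
  obtain ⟨n, -, rfl⟩ := exists_eq_abs_sub_natCast_of_meromorphicOrderAt_kernel_neg Γ k χ hs h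
  exact meromorphicOrderAt_kernel_eq_neg_one_of_kernelSum_ne_zero Γ k χ hs fun hzero =>
    h.not_ge (meromorphicOrderAt_kernel_nonneg_of_kernelSum_eq_zero Γ k χ hs hzero)

end Kernel

/-! ### Square integrability on a set of finite area -/

section SquareIntegrability

variable {V : Type*} [NormedAddCommGroup V] [InnerProductSpace ℂ V]
  {Γ : Subgroup PSL2R} {k : ℝ} {χ : cover Γ → (V ≃ₗᵢ[ℂ] V)} {F : Set ℍ}

theorem MemHk.const_smul {f : ℍ → V} (hf : MemHk Γ k χ F f) (c : ℂ) :
    MemHk Γ k χ F fun z => c • f z where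
  aestronglyMeasurable := hf.aestronglyMeasurable.const_smul c
  slash_eq γ z := by rw [smul_comm, hf.slash_eq, map_smul]
  square_integrable := by
    simp only [enorm_smul, mul_pow]
    rw [lintegral_const_mul' _ _ (ENNReal.pow_ne_top enorm_ne_top)]
    exact ENNReal.mul_lt_top (ENNReal.pow_lt_top enorm_lt_top) hf.square_integrable

theorem J_ne_zero (k : ℝ) (γ : SL(2, ℝ)) (z : ℍ) : J k γ z ≠ 0 :=
  Complex.exp_ne_zero _

variable [CompleteSpace V] [DiscreteTopology Γ]

theorem memHk_kernelSum (hχ : IsMultiplierSystem Γ k χ) (hF : (volume : Measure ℍ) F < ⊤)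
    {s : ℂ} (hs : 1 < s.re) (w : ℍ) (v : V) :
    MemHk Γ k χ F fun z => kernelSum Γ k χ s z w v where
  aestronglyMeasurable :=
    ((continuous_kernelSum_left Γ k χ hs w).clm_apply continuous_const).aestronglyMeasurable
  slash_eq γ z := by
    rw [kernelSum_smul hχ (summable_term Γ k χ hs z w), smul_apply,
      ContinuousLinearMap.comp_apply, toEnd_apply]
    exact inv_smul_smul₀ (J_ne_zero k γ z) _
  square_integrable := by
    obtain ⟨B, hB⟩ := exists_norm_kernelSum_le Γ k χ hs w
    have hbound (z : ℍ) : ‖kernelSum Γ k χ s z w v‖ₑ ^ 2 ≤ ENNReal.ofReal (B * ‖v‖) ^ 2 := by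
      gcongr
      rw [← ofReal_norm]
      exact ENNReal.ofReal_le_ofReal (ContinuousLinearMap.le_of_opNorm_le _ (hB z) v)
    calc ∫⁻ z in F, ‖kernelSum Γ k χ s z w v‖ₑ ^ 2 ≤ ∫⁻ _ in F, ENNReal.ofReal (B * ‖v‖) ^ 2 :=
          lintegral_mono hbound
      _ = ENNReal.ofReal (B * ‖v‖) ^ 2 * volume F := setLIntegral_const F _
      _ < ⊤ := ENNReal.mul_lt_top (ENNReal.pow_lt_top ENNReal.ofReal_lt_top) hF

end SquareIntegrability

end GeomKernel

end

open GeomKernel in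
theorem mainTheorem7_general {V : Type*} [NormedAddCommGroup V] [InnerProductSpace ℂ V]
    [CompleteSpace V] (Γ : Subgroup PSL2R) [DiscreteTopology Γ]
    (F : Set ℍ) (hF_area : (volume : Measure ℍ) F < ⊤)
    (k : ℝ) (χ : cover Γ → (V ≃ₗᵢ[ℂ] V)) (hχ : IsMultiplierSystem Γ k χ) :
    (∀ C : Set (ℍ × ℍ), IsCompact C → ∀ σ : ℝ, 1 < σ →
      (∃ M : cover Γ → ℝ, Summable M ∧
        ∀ γ, ∀ p ∈ C, ∀ s : ℂ, σ ≤ s.re → ‖term Γ k χ γ s p.1 p.2‖ ≤ M γ) ∧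
      HasSumUniformlyOn
        (fun γ (q : (ℍ × ℍ) × ℂ) => term Γ k χ γ q.2 q.1.1 q.1.2)
        (fun q => kernelSum Γ k χ q.2 q.1.1 q.1.2)
        (C ×ˢ {s : ℂ | σ ≤ s.re})) ∧
    (∀ z w : ℍ,
      DifferentiableOn ℂ (fun s => kernelSum Γ k χ s z w) {s : ℂ | 1 < s.re}) ∧
    (∀ z w : ℍ,
      MeromorphicOn (fun s => kernel Γ k χ s z w) {s : ℂ | 1 < s.re} ∧
      (∀ s₀ : ℂ, 1 < s₀.re →
        (¬ ∃ n : ℕ, (n : ℝ) ≤ |k| - 1 ∧ s₀ = ((|k| - n : ℝ) : ℂ)) →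
        AnalyticAt ℂ (fun s => kernel Γ k χ s z w) s₀) ∧
      (∀ s₀ : ℂ, 1 < s₀.re →
        meromorphicOrderAt (fun s => kernel Γ k χ s z w) s₀ < 0 →
        1 < |k| ∧ (∃ n : ℕ, (n : ℝ) ≤ |k| - 1 ∧ s₀ = ((|k| - n : ℝ) : ℂ)) ∧
        meromorphicOrderAt (fun s => kernel Γ k χ s z w) s₀ = -1) ∧
      (∀ n : ℕ, 1 < |k| - n →
        (meromorphicOrderAt (fun s => kernel Γ k χ s z w) ((|k| - n : ℝ) : ℂ) = -1 ↔
          kernelSum Γ k χ ((|k| - n : ℝ) : ℂ) z w ≠ 0))) ∧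
    (∀ (w : ℍ) (s : ℂ), max 1 |k| < s.re → ∀ v : V,
      MemHk Γ k χ F (fun z => kernel Γ k χ s z w v)) := by
  refine ⟨fun C hC σ hσ => ⟨exists_summable_norm_term_le Γ k χ hC hσ,
      hasSumUniformlyOn_term Γ k χ hC hσ⟩,
    differentiableOn_kernelSum Γ k χ,
    fun z w => ⟨meromorphicOn_kernel Γ k χ z w, fun s hs hregular => ?_, fun s hs hpole => ?_,
      fun n hn => meromorphicOrderAt_kernel_eq_neg_one_iff Γ k χ hn z w⟩,
    fun w s hs v => ?_⟩
  · refine analyticAt_kernel Γ k χ hs (fun n hn => hregular ⟨n, ?_, hn⟩) z w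
    rw [hn, Complex.ofReal_re] at hs
    linarith
  · exact ⟨one_lt_abs_of_meromorphicOrderAt_kernel_neg Γ k χ hs hpole,
      exists_eq_abs_sub_natCast_of_meromorphicOrderAt_kernel_neg Γ k χ hs hpole,
      meromorphicOrderAt_kernel_eq_neg_one_of_neg Γ k χ hs hpole⟩
  · exact (memHk_kernelSum hχ hF_area ((le_max_left _ _).trans_lt hs) w v).const_smul
      (gammaFactor k s)

theorem mainTheorem7 {V : Type*} [NormedAddCommGroup V] [InnerProductSpace ℂ V]
    [FiniteDimensional ℂ V]
    -- a Fuchsian group with a fundamental domain of finite hyperbolic area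
    (Γ : Subgroup GeomKernel.PSL2R) [DiscreteTopology Γ]
    (F : Set ℍ) (hF : IsFundamentalDomain Γ F (volume : Measure ℍ))
    (hF_area : (volume : Measure ℍ) F < ⊤)
    (k : ℝ) (χ : GeomKernel.cover Γ → (V ≃ₗᵢ[ℂ] V)) (hχ : GeomKernel.IsMultiplierSystem Γ k χ) :
    -- (a) normal convergence in `(z, w; s)`, uniform convergence on compacta
    (∀ C : Set (ℍ × ℍ), IsCompact C → ∀ σ : ℝ, 1 < σ →
      (∃ M : GeomKernel.cover Γ → ℝ, Summable M ∧
        ∀ γ, ∀ p ∈ C, ∀ s : ℂ, σ ≤ s.re → ‖GeomKernel.term Γ k χ γ s p.1 p.2‖ ≤ M γ) ∧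
      HasSumUniformlyOn
        (fun γ (q : (ℍ × ℍ) × ℂ) => GeomKernel.term Γ k χ γ q.2 q.1.1 q.1.2)
        (fun q => GeomKernel.kernelSum Γ k χ q.2 q.1.1 q.1.2)
        (C ×ˢ {s : ℂ | σ ≤ s.re})) ∧
    -- (a) holomorphy of the sum in `s`
    (∀ z w : ℍ,
      DifferentiableOn ℂ (fun s => GeomKernel.kernelSum Γ k χ s z w) {s : ℂ | 1 < s.re}) ∧
    -- (b) meromorphy of the kernel in `s`, and its poles
    (∀ z w : ℍ,
      MeromorphicOn (fun s => GeomKernel.kernel Γ k χ s z w) {s : ℂ | 1 < s.re} ∧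
      (∀ s₀ : ℂ, 1 < s₀.re →
        (¬ ∃ n : ℕ, (n : ℝ) ≤ |k| - 1 ∧ s₀ = ((|k| - n : ℝ) : ℂ)) →
        AnalyticAt ℂ (fun s => GeomKernel.kernel Γ k χ s z w) s₀) ∧
      (∀ s₀ : ℂ, 1 < s₀.re →
        meromorphicOrderAt (fun s => GeomKernel.kernel Γ k χ s z w) s₀ < 0 →
        1 < |k| ∧ (∃ n : ℕ, (n : ℝ) ≤ |k| - 1 ∧ s₀ = ((|k| - n : ℝ) : ℂ)) ∧
        meromorphicOrderAt (fun s => GeomKernel.kernel Γ k χ s z w) s₀ = -1) ∧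
      (∀ n : ℕ, 1 < |k| - n →
        (meromorphicOrderAt (fun s => GeomKernel.kernel Γ k χ s z w) ((|k| - n : ℝ) : ℂ) = -1 ↔
          GeomKernel.kernelSum Γ k χ ((|k| - n : ℝ) : ℂ) z w ≠ 0))) ∧
    -- (c) the columns (images of fixed vectors) belong to `ℋ_k`
    (∀ (w : ℍ) (s : ℂ), max 1 |k| < s.re → ∀ v : V,
      GeomKernel.MemHk Γ k χ F (fun z => GeomKernel.kernel Γ k χ s z w v)) := by
  have : CompleteSpace V := FiniteDimensional.complete ℂ V
  exact mainTheorem7_general Γ F hF_area k χ hχ
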